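/- **Theorem.** For a vector $(\beta_1^{(0)},\beta_2^{(0)},\beta_3^{(0)})\in\mathbb R^3$, its Jacobi–Perron (JPA) expansion is the sequence of vectors given by $$\beta^{(k+1)}=\left(\beta_2^{(k)}-\left\lfloor \frac{\beta_2^{(k)}}{\beta_1^{(k)}}\right\rfloor\beta_1^{(k)},\ \beta_3^{(k)}-\left\lfloor \frac{\beta_3^{(k)}}{\beta_1^{(k)}}\right\rfloor\beta_1^{(k)},\ \beta_1^{(k)}\right).$$ For real numbers $\gamma_1,\gamma_2,\dots$ let $\langle\gamma_1,\gamma_2,\ldots\rangle$ denote the additive group they generate, and let $N$ denote the norm from the cubic field in question to $\mathbb Q$. (1) Let $a\ge 3$ be an integer, let $K=\mathbb Q(\rho)$ with $\rho$ a root of $x^3+(a-1)x^2-ax-1$, and let $$S=\{-v-(a(v-1)+w)\rho+(a(v-1)+w+1)\rho^2 \;:\; v,w\in\mathbb Z,\ 1\le v\le a-1,\ \max\{1,v-1\}\le w\le a-1\}.$$ Let $\tau$ be one of the roots of the same polynomial, let $\sigma:K\to\mathbb R$ be the embedding with $\sigma(\rho)=\tau$, and let $\langle\beta^{(k)}\rangle_{k\ge0}$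 be the JPA expansion of $(1,|\tau|,\tau^2)$. Let $k\ge 0$ and let $\varepsilon$ be a unit of the ring of integers of $\mathbb Q(\tau)$ such that $$L:=\langle\alpha-\beta \mid \alpha,\beta\in\sigma(S)\rangle=\langle\beta_1^{(k)}\varepsilon,\beta_2^{(k)}\varepsilon\rangle\quad\text{and}\quad |N(\beta_3^{(k)})|\le a^2-5a .$$ Then, after replacing $\varepsilon$ by $-\varepsilon$ if necessary, $\sigma(S)\subset\beta_3^{(k)}\varepsilon+L$. (2) Let $a\ge 5$ be an integer, let $K=\mathbb Q(\psi)$ with $\psi$ a root of $x^3-(a-1)x^2-ax-1$, and let $$\tilde S=\{1+v-u+au+(a-u+au)\psi-(u+1)\psi^2 \;:\; v,u\in\mathbb Z,\ 1\le v\le a-3,\ 0\le u\le v,\ (v,u)\ne(1,0)\}.$$ Let $\tau$ be one of the roots of the same polynomial, let $\sigma:K\to\mathbb R$ be the embedding with $\sigma(\psi)=\tau$, and let $\langle\beta^{(k)}\rangle_{k\ge0}$ be the JPA expansion of $(1,|\tau|,\tau^2)$. Let $k\ge 0$ and let $\varepsilon$ be a unit of the ring of integers of $\mathbb Q(\tau)$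 such that $$L:=\langle\alpha-\beta \mid \alpha,\beta\in\sigma(\tilde S)\rangle=\langle\beta_1^{(k)}\varepsilon,\beta_2^{(k)}\varepsilon\rangle\quad\text{and}\quad |N(\beta_3^{(k)})|\le a^2-5a .$$ Then, after replacing $\varepsilon$ by $-\varepsilon$ if necessary, $\sigma(\tilde S)\subset\beta_3^{(k)}\varepsilon+L$. -/

import Mathlib

open NumberField

/-- One step of the homogeneous Jacobi--Perron algorithm on a vector `β = (β₁, …, βₙ₊₁)`
(indexed here by `0, …, n`):
`(β₂ - ⌊β₂/β₁⌋ β₁, …, βₙ₊₁ - ⌊βₙ₊₁/β₁⌋ β₁, β₁)`. -/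
noncomputable def jpaStep {n : ℕ} (β : Fin (n + 1) → ℝ) : Fin (n + 1) → ℝ :=
  Fin.snoc (α := fun _ => ℝ)
    (fun i : Fin n => β i.succ - (⌊β i.succ / β 0⌋ : ℝ) * β 0) (β 0)

/-- The Jacobi--Perron expansion `⟨β⁽ᵏ⁾⟩` of the vector `β`. -/
noncomputable def jpa {n : ℕ} (β : Fin (n + 1) → ℝ) (k : ℕ) : Fin (n + 1) → ℝ :=
  jpaStep^[k] β

theorem jpa_mem {n : ℕ} (F : Subfield ℝ) (β : Fin (n + 1) → ℝ) (hβ : ∀ i, β i ∈ F)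
    (k : ℕ) (i : Fin (n + 1)) : jpa β k i ∈ F := by
  induction k generalizing i with
  | zero => exact hβ i
  | succ k ih =>
    have h : jpa β (k + 1) = jpaStep (jpa β k) := Function.iterate_succ_apply' _ _ _
    rw [h, jpaStep]
    refine Fin.lastCases ?_ (fun j => ?_) i
    · rw [Fin.snoc_last]
      exact ih 0
    · rw [Fin.snoc_castSucc]
      exact F.sub_mem (ih _) (F.mul_mem (intCast_mem F _) (ih 0))

theorem initial_mem {K : Type*} [Field K] (σ : K →+* ℝ) (ρ : K) (i : Fin 3) :
    (![1, |σ ρ|, (σ ρ) ^ 2] : Fin 3 → ℝ) i ∈ σ.fieldRange := by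
  have h : σ ρ ∈ σ.fieldRange := ⟨ρ, rfl⟩
  fin_cases i
  · exact σ.fieldRange.one_mem
  · rcases abs_choice (σ ρ) with h' | h'
    · change |σ ρ| ∈ σ.fieldRange
      rw [h']
      exact h
    · change |σ ρ| ∈ σ.fieldRange
      rw [h']
      exact σ.fieldRange.neg_mem h
  · exact σ.fieldRange.pow_mem h 2

/-- For `τ = σ(ρ)`, the convergent `βᵢ⁽ᵏ⁾` of the Jacobi--Perron expansion of `(1, |τ|, τ²)`,
as an element of the field `σ(K)`. The indices `i = 0, 1, 2` stand for `β₁, β₂, β₃`. -/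
noncomputable def convergent {K : Type*} [Field K] (σ : K →+* ℝ) (ρ : K) (k : ℕ) (i : Fin 3) :
    σ.fieldRange :=
  ⟨jpa ![1, |σ ρ|, (σ ρ) ^ 2] k i, jpa_mem _ _ (initial_mem σ ρ) k i⟩

/-- The triangle `S` of the elements `λ_{v,w}`. -/
def triangleS {K : Type*} [Field K] (a : ℤ) (ρ : K) : Set K :=
  {x | ∃ v w : ℤ, 1 ≤ v ∧ v ≤ a - 1 ∧ max 1 (v - 1) ≤ w ∧ w ≤ a - 1 ∧
    x = ((-v : ℤ) : K) - ((a * (v - 1) + w : ℤ) : K) * ρ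
      + ((a * (v - 1) + w + 1 : ℤ) : K) * ρ ^ 2}

/-- The triangle `S̃` of the elements `λ̃_{v,u}`. -/
def triangleSTilde {K : Type*} [Field K] (a : ℤ) (ψ : K) : Set K :=
  {x | ∃ v u : ℤ, 1 ≤ v ∧ v ≤ a - 3 ∧ 0 ≤ u ∧ u ≤ v ∧ (v, u) ≠ (1, 0) ∧
    x = ((1 + v - u + a * u : ℤ) : K) + ((a - u + a * u : ℤ) : K) * ψ
      - ((u + 1 : ℤ) : K) * ψ ^ 2}

/-- The lattice `⟨α - β | α, β ∈ T⟩` generated by the differences of elements of `T`. -/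
def differenceLattice (T : Set ℝ) : AddSubgroup ℝ :=
  AddSubgroup.closure {x | ∃ α ∈ T, ∃ β ∈ T, x = α - β}

/-- The translate `x + L` of the lattice `L`. -/
def latticeCoset (x : ℝ) (L : AddSubgroup ℝ) : Set ℝ := {y | ∃ l ∈ L, y = x + l}

/-! Put `O = ℤ[τ]`. Both triangles lie in `τ + L`, where `L = ℤ + ℤθ` with `θ = cτ ± τ²`, so `O = L
⊕ ℤτ` and `O/L` is infinite cyclic, generated by `τ`. Every Jacobi–Perron step is unimodular, so
each `β⁽ᵏ⁾` is again a `ℤ`-basis of `O` (`closure_range_jpa`). From `1 ∈ L = ⟨β₁ε, β₂ε⟩` follows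
`ε⁻¹ ∈ O`, and then `ε ∈ O` by integrality, so `εO = O`. Hence `β₃ε` also generates `O/L`. Two
generators of an infinite cyclic group agree up to sign, so `τ ≡ ±β₃ε` modulo `L`
(`sub_or_add_jpa_mem`). -/

theorem exists_sub_or_add_mem_of_generate {G : Type*} [AddCommGroup G] {L : AddSubgroup G}
    {u w : G} {m n : ℤ} (hu : ∀ k : ℤ, k • u ∈ L → k = 0)
    (hw : w - n • u ∈ L) (hu' : u - m • w ∈ L) : u - w ∈ L ∨ u + w ∈ L := by
  have h : (1 - m * n) • u ∈ L := by
    have h' := L.add_mem hu' (L.zsmul_mem hw m)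
    convert h' using 1
    rw [sub_smul, one_smul, mul_smul, smul_sub]
    abel
  -- Since `u ≡ m w ≡ mn u` modulo `L` and `u` has infinite order there, `m` and `n` are inverse
  -- integers.
  have hmn : m * n = 1 := by have := hu _ h; lia
  rcases Int.eq_one_or_neg_one_of_mul_eq_one' hmn with ⟨-, rfl⟩ | ⟨-, rfl⟩
  · left
    have := L.neg_mem hw
    rwa [one_smul, neg_sub] at this
  · right
    rwa [neg_smul, one_smul, sub_neg_eq_add, add_comm] at hw

/-- Dividing a monic equation of degree `n` by `x ^ (n - 1)` writes `x` as an integer polynomial in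
`x⁻¹`. -/
theorem IsIntegral.mem_subring_of_inv_mem {F : Type*} [Field F] {S : Subring F} {x : F}
    (hx : IsIntegral ℤ x) (hinv : x⁻¹ ∈ S) : x ∈ S := by
  rcases eq_or_ne x 0 with rfl | hx0
  · exact S.zero_mem
  obtain ⟨p, hp, hpx⟩ := hx
  rw [Polynomial.eval₂_eq_sum_range, Finset.sum_range_succ, hp.coeff_natDegree, map_one,
    one_mul] at hpx
  rcases Nat.eq_zero_or_pos p.natDegree with h0 | hpos
  · simp [h0] at hpx
  have key : x = -∑ i ∈ Finset.range p.natDegree,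
      (p.coeff i : F) * x⁻¹ ^ (p.natDegree - 1 - i) := by
    have hpow : x ^ (p.natDegree - 1) ≠ 0 := pow_ne_zero _ hx0
    apply mul_left_cancel₀ hpow
    rw [← pow_succ, Nat.sub_add_cancel hpos, eq_neg_of_add_eq_zero_right hpx, mul_neg,
      Finset.mul_sum]
    congr 1
    refine Finset.sum_congr rfl fun i hi => ?_
    have hi' : i ≤ p.natDegree - 1 := by have := Finset.mem_range.1 hi; lia
    rw [mul_left_comm, inv_pow, eq_intCast]
    congr 1
    rw [eq_mul_inv_iff_mul_eq₀ (pow_ne_zero _ hx0), ← pow_add, Nat.add_sub_of_le hi']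
  rw [key]
  exact S.neg_mem (S.sum_mem fun i _ => S.mul_mem (intCast_mem S _) (S.pow_mem hinv _))

/-! ### The cubic order and independence of `1, t, t²`. -/

/-- The order `ℤ + ℤt + ℤt²`, for `t` a root of `x³ - Ax² - Bx - 1`. -/
def cubicOrder {t : ℝ} {A B : ℤ} (ht : t ^ 3 = A * t ^ 2 + B * t + 1) : Subring ℝ where
  carrier := {x | ∃ p q r : ℤ, x = p + q * t + r * t ^ 2}
  zero_mem' := ⟨0, 0, 0, by simp⟩
  one_mem' := ⟨1, 0, 0, by simp⟩
  add_mem' := by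
    rintro _ _ ⟨p, q, r, rfl⟩ ⟨p', q', r', rfl⟩
    exact ⟨p + p', q + q', r + r', by push_cast; ring⟩
  neg_mem' := by
    rintro _ ⟨p, q, r, rfl⟩
    exact ⟨-p, -q, -r, by push_cast; ring⟩
  mul_mem' := by
    rintro _ _ ⟨p, q, r, rfl⟩ ⟨p', q', r', rfl⟩
    -- Reduction by `t³ = At² + Bt + 1` and `t⁴ = (A² + B)t² + (AB + 1)t + A`.
    refine ⟨p * p' + (q * r' + r * q') + A * (r * r'),
      p * q' + q * p' + B * (q * r' + r * q') + (A * B + 1) * (r * r'),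
      p * r' + q * q' + r * p' + A * (q * r' + r * q') + (A ^ 2 + B) * (r * r'), ?_⟩
    push_cast
    linear_combination ((q : ℝ) * r' + r * q' + r * r' * t + A * (r * r')) * ht

/-- An integer root divides the constant term, hence is `±1`; `h₁` and `h₂` exclude `1` and `-1`. -/
theorem irreducible_cubic {A B : ℤ} (h₁ : A + B ≠ 0) (h₂ : A - B + 2 ≠ 0) :
    Irreducible (Polynomial.X ^ 3 - Polynomial.C A * Polynomial.X ^ 2
      - Polynomial.C B * Polynomial.X - 1 : Polynomial ℤ) := by
  have hdeg : (Polynomial.X ^ 3 - Polynomial.C A * Polynomial.X ^ 2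
      - Polynomial.C B * Polynomial.X - 1 : Polynomial ℤ).natDegree = 3 := by compute_degree!
  have hmonic : (Polynomial.X ^ 3 - Polynomial.C A * Polynomial.X ^ 2
      - Polynomial.C B * Polynomial.X - 1 : Polynomial ℤ).Monic := by monicity!
  rw [hmonic.irreducible_iff_roots_eq_zero_of_degree_le_three (by lia) (by lia)]
  refine Multiset.eq_zero_of_forall_notMem fun x hx => ?_
  have hroot := (Polynomial.mem_roots'.1 hx).2
  simp only [Polynomial.IsRoot, Polynomial.eval_sub, Polynomial.eval_pow, Polynomial.eval_X,
    Polynomial.eval_mul, Polynomial.eval_C, Polynomial.eval_one] at hroot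
  have hmul : x * (x ^ 2 - A * x - B) = 1 := by linear_combination hroot
  rcases Int.eq_one_or_neg_one_of_mul_eq_one hmul with rfl | rfl
  · exact h₁ (by linear_combination -hroot)
  · exact h₂ (by linear_combination -hroot)

theorem eq_zero_of_quadratic_relation {t : ℝ} {A B : ℤ}
    (ht : t ^ 3 = A * t ^ 2 + B * t + 1) (h₁ : A + B ≠ 0) (h₂ : A - B + 2 ≠ 0)
    {p q r : ℤ} (h : (p : ℝ) + q * t + r * t ^ 2 = 0) : p = 0 ∧ q = 0 ∧ r = 0 := by
  set f : Polynomial ℤ := Polynomial.X ^ 3 - Polynomial.C A * Polynomial.X ^ 2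
      - Polynomial.C B * Polynomial.X - 1 with hf
  have hdeg : f.natDegree = 3 := by rw [hf]; compute_degree!
  have hmonic : f.Monic := by rw [hf]; monicity!
  have hroot : Polynomial.aeval t f = 0 := by
    simp [hf]
    linear_combination ht
  have hint : IsIntegral ℤ t := ⟨f, hmonic, hroot⟩
  have hmin : f = minpoly ℤ t := by
    refine Polynomial.eq_of_monic_of_associated hmonic (minpoly.monic hint) ?_
    exact ((irreducible_cubic h₁ h₂).dvd_iff.1
      (minpoly.isIntegrallyClosed_dvd hint hroot)).resolve_left (minpoly.not_isUnit ℤ t)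
  have hg : Polynomial.C p + Polynomial.C q * Polynomial.X
      + Polynomial.C r * Polynomial.X ^ 2 = (0 : Polynomial ℤ) := by
    by_contra hg0
    have hle := Polynomial.natDegree_le_natDegree
      (minpoly.IsIntegrallyClosed.degree_le_of_ne_zero (s := t) hg0 (by simpa using h))
    rw [← hmin, hdeg] at hle
    have : (Polynomial.C p + Polynomial.C q * Polynomial.X
      + Polynomial.C r * Polynomial.X ^ 2 : Polynomial ℤ).natDegree ≤ 2 := by compute_degree
    lia
  have hc (i : ℕ) := congrArg (fun P : Polynomial ℤ => P.coeff i) hg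
  simp only [Polynomial.coeff_add, Polynomial.coeff_C_mul, Polynomial.coeff_C,
    Polynomial.coeff_X, Polynomial.coeff_X_pow, Polynomial.coeff_zero] at hc
  exact ⟨by simpa using hc 0, by simpa using hc 1, by simpa using hc 2⟩

/-! ### Invariance of the lattice under Jacobi–Perron steps. -/

theorem mem_closure_range_jpaStep {n : ℕ} (β : Fin (n + 1) → ℝ) (i : Fin (n + 1)) :
    jpaStep β i ∈ AddSubgroup.closure (Set.range β) := by
  have hmem (j) : β j ∈ AddSubgroup.closure (Set.range β) :=
    AddSubgroup.subset_closure ⟨j, rfl⟩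
  refine Fin.lastCases ?_ (fun j => ?_) i
  · rw [jpaStep, Fin.snoc_last]
    exact hmem 0
  · rw [jpaStep, Fin.snoc_castSucc, ← zsmul_eq_mul]
    exact sub_mem (hmem _) (zsmul_mem (hmem 0) _)

theorem mem_closure_range_of_jpaStep {n : ℕ} (β : Fin (n + 1) → ℝ) (i : Fin (n + 1)) :
    β i ∈ AddSubgroup.closure (Set.range (jpaStep β)) := by
  have hmem (j) : jpaStep β j ∈ AddSubgroup.closure (Set.range (jpaStep β)) :=
    AddSubgroup.subset_closure ⟨j, rfl⟩
  have h0 : β 0 ∈ AddSubgroup.closure (Set.range (jpaStep β)) := by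
    have := hmem (Fin.last n)
    rwa [jpaStep, Fin.snoc_last, ← jpaStep] at this
  refine Fin.cases h0 (fun j => ?_) i
  have := add_mem (hmem j.castSucc) (zsmul_mem h0 ⌊β j.succ / β 0⌋)
  rwa [zsmul_eq_mul, show jpaStep β j.castSucc = β j.succ - (⌊β j.succ / β 0⌋ : ℝ) * β 0 by
    rw [jpaStep, Fin.snoc_castSucc], sub_add_cancel] at this

theorem closure_range_jpa {n : ℕ} (β : Fin (n + 1) → ℝ) (k : ℕ) :
    AddSubgroup.closure (Set.range (jpa β k)) = AddSubgroup.closure (Set.range β) := by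
  induction k with
  | zero => rfl
  | succ k ih =>
    rw [← ih, show jpa β (k + 1) = jpaStep (jpa β k) from Function.iterate_succ_apply' _ _ _]
    apply le_antisymm <;> rw [AddSubgroup.closure_le] <;> rintro _ ⟨i, rfl⟩
    · exact mem_closure_range_jpaStep _ i
    · exact mem_closure_range_of_jpaStep _ i

theorem mem_closure_range_fin_three {b : Fin 3 → ℝ} {x : ℝ} :
    x ∈ AddSubgroup.closure (Set.range b) ↔ ∃ p q r : ℤ, x = p * b 0 + q * b 1 + r * b 2 := by
  constructor
  · intro hx
    induction hx using AddSubgroup.closure_induction with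
    | mem x hx =>
      obtain ⟨i, rfl⟩ := hx
      fin_cases i
      · exact ⟨1, 0, 0, by simp⟩
      · exact ⟨0, 1, 0, by simp⟩
      · exact ⟨0, 0, 1, by simp⟩
    | zero => exact ⟨0, 0, 0, by simp⟩
    | add x y _ _ hx hy =>
      obtain ⟨p, q, r, rfl⟩ := hx
      obtain ⟨p', q', r', rfl⟩ := hy
      exact ⟨p + p', q + q', r + r', by push_cast; ring⟩
    | neg x _ hx =>
      obtain ⟨p, q, r, rfl⟩ := hx
      exact ⟨-p, -q, -r, by push_cast; ring⟩
  · rintro ⟨p, q, r, rfl⟩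
    simp only [← zsmul_eq_mul]
    have hmem (i) : b i ∈ AddSubgroup.closure (Set.range b) :=
      AddSubgroup.subset_closure ⟨i, rfl⟩
    exact add_mem (add_mem (zsmul_mem (hmem 0) _)
      (zsmul_mem (hmem 1) _))
      (zsmul_mem (hmem 2) _)

theorem mem_cubicOrder_iff_jpa {t : ℝ} {A B : ℤ} (ht : t ^ 3 = A * t ^ 2 + B * t + 1) (k : ℕ)
    {x : ℝ} : x ∈ cubicOrder ht ↔ ∃ p q r : ℤ, x = p * jpa ![1, |t|, t ^ 2] k 0 +
      q * jpa ![1, |t|, t ^ 2] k 1 + r * jpa ![1, |t|, t ^ 2] k 2 := by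
  rw [← mem_closure_range_fin_three, closure_range_jpa, mem_closure_range_fin_three]
  change (∃ p q r : ℤ, x = p + q * t + r * t ^ 2) ↔
    ∃ p q r : ℤ, x = p * 1 + q * |t| + r * t ^ 2
  rcases abs_choice t with h | h <;> rw [h]
  · simp
  -- Here `|t| = -t`, which only flips the sign of the middle coordinate.
  · constructor <;> rintro ⟨p, q, r, rfl⟩ <;> exact ⟨p, -q, r, by push_cast; ring⟩

/-! ### Comparison of the generators `t` and `β₃e` modulo `L`. -/

/-- If `L = ℤ + ℤθ` is a complement of `ℤt` in the order `ℤ + ℤt + ℤt²`, and also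
`L = ℤβ₁e + ℤβ₂e` with `e` an algebraic integer, then `t ≡ ±β₃e` modulo `L`. -/
theorem sub_or_add_jpa_mem {t : ℝ} {A B c d : ℤ} (ht : t ^ 3 = A * t ^ 2 + B * t + 1)
    (h₁ : A + B ≠ 0) (h₂ : A - B + 2 ≠ 0) (hd : d * d = 1) {L : AddSubgroup ℝ}
    (hL : L = AddSubgroup.closure {1, c * t + d * t ^ 2}) {e : ℝ} (he : IsIntegral ℤ e) (k : ℕ)
    (hLe : L = AddSubgroup.closure
      {jpa ![1, |t|, t ^ 2] k 0 * e, jpa ![1, |t|, t ^ 2] k 1 * e}) :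
    t - jpa ![1, |t|, t ^ 2] k 2 * e ∈ L ∨ t + jpa ![1, |t|, t ^ 2] k 2 * e ∈ L := by
  set b := jpa ![1, |t|, t ^ 2] k with hb
  have hmemL {x : ℝ} : x ∈ L ↔ ∃ p q : ℤ, p • (1 : ℝ) + q • (c * t + d * t ^ 2) = x := by
    rw [hL, AddSubgroup.mem_closure_pair]
  have hmemLe {x : ℝ} : x ∈ L ↔ ∃ p q : ℤ, p • (b 0 * e) + q • (b 1 * e) = x := by
    rw [hLe, AddSubgroup.mem_closure_pair]
  have htO : t ∈ cubicOrder ht := ⟨0, 1, 0, by simp⟩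
  obtain ⟨p, q, h1⟩ := hmemLe.1 (hmemL.2 ⟨1, 0, by simp⟩ : (1 : ℝ) ∈ L)
  simp only [zsmul_eq_mul] at h1
  have hinv : e⁻¹ = p * b 0 + q * b 1 :=
    inv_eq_of_mul_eq_one_left (by linear_combination h1)
  have hinvO : e⁻¹ ∈ cubicOrder ht :=
    (mem_cubicOrder_iff_jpa ht k).2 ⟨p, q, 0, by rw [hinv]; simp [hb]⟩
  have he0 : e ≠ 0 := by
    rintro rfl
    simp at h1
  have hbO : b 2 ∈ cubicOrder ht := (mem_cubicOrder_iff_jpa ht k).2 ⟨0, 0, 1, by simp [hb]⟩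
  obtain ⟨x, y, m, hm⟩ := (mem_cubicOrder_iff_jpa ht k).1 (mul_mem hinvO htO)
  obtain ⟨x', y', z', hn⟩ := mul_mem hbO (he.mem_subring_of_inv_mem hinvO)
  rw [inv_mul_eq_iff_eq_mul₀ he0] at hm
  have hd' : (d : ℝ) * d = 1 := by exact_mod_cast hd
  -- `m` is the `β₃`-coordinate of `e⁻¹t`. As `d² = 1`, `t² ≡ -dct` modulo `L`, so `β₃e = x' + y't +
  -- z't² ≡ (y' - dz'c)t`.
  refine exists_sub_or_add_mem_of_generate (m := m) (n := y' - d * z' * c) (fun n hn' => ?_) ?_ ?_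
  · obtain ⟨p, q, h⟩ := hmemL.1 hn'
    simp only [zsmul_eq_mul] at h
    obtain ⟨-, hn0, hq⟩ := eq_zero_of_quadratic_relation ht h₁ h₂
      (p := p) (q := q * c - n) (r := q * d) (by push_cast; linear_combination h)
    have hq0 : q = 0 := by
      rcases mul_eq_zero.1 hq with h | rfl
      · exact h
      · simp at hd
    rw [hq0] at hn0
    lia
  · refine hmemL.2 ⟨x', d * z', ?_⟩
    rw [hn]
    simp only [zsmul_eq_mul]
    push_cast
    linear_combination (z' * t ^ 2) * hd'
  · refine hmemLe.2 ⟨x, y, ?_⟩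
    simp only [zsmul_eq_mul]
    linear_combination -hm

theorem exists_unit_subset_latticeCoset {K : Type*} [Field K] [NumberField K] {ρ : K} (σ : K →+* ℝ)
    {A B c d : ℤ} (ht : σ ρ ^ 3 = A * σ ρ ^ 2 + B * σ ρ + 1)
    (h₁ : A + B ≠ 0) (h₂ : A - B + 2 ≠ 0) (hd : d * d = 1) {T : Set ℝ}
    (hT : differenceLattice T = AddSubgroup.closure {1, c * σ ρ + d * σ ρ ^ 2})
    (hTρ : ∀ y ∈ T, y - σ ρ ∈ differenceLattice T) (k : ℕ) (ε : (𝓞 K)ˣ)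
    (hε : differenceLattice T = AddSubgroup.closure
      {(convergent σ ρ k 0 : ℝ) * σ ((ε : 𝓞 K) : K),
        (convergent σ ρ k 1 : ℝ) * σ ((ε : 𝓞 K) : K)}) :
    ∃ η : (𝓞 K)ˣ, (η = ε ∨ η = -ε) ∧
      T ⊆ latticeCoset ((convergent σ ρ k 2 : ℝ) * σ ((η : 𝓞 K) : K)) (differenceLattice T) := by
  have he : IsIntegral ℤ (σ ((ε : 𝓞 K) : K)) :=
    (RingOfIntegers.isIntegral_coe (ε : 𝓞 K)).map (σ.toIntAlgHom)
  rcases sub_or_add_jpa_mem ht h₁ h₂ hd hT he k hε with h | h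
  · refine ⟨ε, Or.inl rfl, fun y hy => ⟨_, add_mem (hTρ y hy) h, ?_⟩⟩
    simp only [convergent]
    ring
  · refine ⟨-ε, Or.inr rfl, fun y hy => ⟨_, add_mem (hTρ y hy) h, ?_⟩⟩
    simp only [convergent, Units.val_neg, map_neg]
    ring

/-! ### The difference lattices of the two triangles. -/

theorem sub_mem_differenceLattice {T : Set ℝ} {α β : ℝ} (hα : α ∈ T) (hβ : β ∈ T) :
    α - β ∈ differenceLattice T :=
  AddSubgroup.subset_closure ⟨α, hα, β, hβ, rfl⟩

theorem differenceLattice_eq_closure_pair {T : Set ℝ} {t x y : ℝ}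
    (hT : ∀ z ∈ T, z - t ∈ AddSubgroup.closure {x, y})
    (hx : x ∈ differenceLattice T) (hy : y ∈ differenceLattice T) :
    differenceLattice T = AddSubgroup.closure {x, y} := by
  apply le_antisymm
  · rw [differenceLattice, AddSubgroup.closure_le]
    rintro _ ⟨α, hα, β, hβ, rfl⟩
    have := sub_mem (hT α hα) (hT β hβ)
    rwa [sub_sub_sub_cancel_right] at this
  · rw [AddSubgroup.closure_le]
    rintro z (rfl | rfl)
    · exact hx
    · exact hy

theorem sub_mem_of_mem_triangleS {K : Type*} [Field K] {a : ℤ} {ρ : K} (σ : K →+* ℝ) :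
    ∀ z ∈ σ '' triangleS a ρ,
      z - σ ρ ∈ AddSubgroup.closure {1, ((-1 : ℤ) : ℝ) * σ ρ + ((1 : ℤ) : ℝ) * σ ρ ^ 2} := by
  rintro _ ⟨_, ⟨v, w, -, -, -, -, rfl⟩, rfl⟩
  rw [AddSubgroup.mem_closure_pair]
  -- `λ_{v,w} = ρ - v + (a(v-1) + w + 1)(ρ² - ρ)`.
  refine ⟨-v, a * (v - 1) + w + 1, ?_⟩
  simp only [zsmul_eq_mul, map_add, map_sub, map_mul, map_pow, map_intCast]
  push_cast
  ring

theorem differenceLattice_triangleS {K : Type*} [Field K] {a : ℤ} (ha : 3 ≤ a) {ρ : K}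
    (σ : K →+* ℝ) : differenceLattice (σ '' triangleS a ρ) =
      AddSubgroup.closure {1, ((-1 : ℤ) : ℝ) * σ ρ + ((1 : ℤ) : ℝ) * σ ρ ^ 2} := by
  have hmem (v w : ℤ) (hv : 1 ≤ v) (hv' : v ≤ a - 1) (hw : max 1 (v - 1) ≤ w) (hw' : w ≤ a - 1) :
      ((-v : ℤ) : ℝ) - ((a * (v - 1) + w : ℤ) : ℝ) * σ ρ
        + ((a * (v - 1) + w + 1 : ℤ) : ℝ) * σ ρ ^ 2 ∈ σ '' triangleS a ρ :=
    ⟨_, ⟨v, w, hv, hv', hw, hw', rfl⟩, by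
      simp only [map_add, map_sub, map_mul, map_pow, map_intCast]⟩
  have h11 := hmem 1 1 le_rfl (by lia) (by simp) (by lia)
  have h12 := hmem 1 2 le_rfl (by lia) (by simp) (by lia)
  have h21 := hmem 2 1 (by lia) (by lia) (by simp) (by lia)
  refine differenceLattice_eq_closure_pair (sub_mem_of_mem_triangleS σ) ?_ ?_
  -- With `θ = ρ² - ρ`: `λ₁₂ - λ₁₁ = θ` and `λ₁₁ - λ₂₁ = 1 - aθ`.
  · convert add_mem (sub_mem_differenceLattice h11 h21)
      (zsmul_mem (sub_mem_differenceLattice h12 h11) a) using 1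
    rw [zsmul_eq_mul]
    push_cast
    ring
  · convert sub_mem_differenceLattice h12 h11 using 1
    push_cast
    ring

theorem sub_mem_of_mem_triangleSTilde {K : Type*} [Field K] {a : ℤ} {ψ : K} (σ : K →+* ℝ) :
    ∀ z ∈ σ '' triangleSTilde a ψ,
      z - σ ψ ∈ AddSubgroup.closure {1, ((a - 1 : ℤ) : ℝ) * σ ψ + ((-1 : ℤ) : ℝ) * σ ψ ^ 2} := by
  rintro _ ⟨_, ⟨v, u, -, -, -, -, -, rfl⟩, rfl⟩
  rw [AddSubgroup.mem_closure_pair]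
  -- The coefficient of `ψ` is `a - u + au = 1 + (u + 1)(a - 1)`.
  refine ⟨1 + v - u + a * u, u + 1, ?_⟩
  simp only [zsmul_eq_mul, map_add, map_sub, map_mul, map_pow, map_intCast]
  push_cast
  ring

theorem differenceLattice_triangleSTilde {K : Type*} [Field K] {a : ℤ} (ha : 5 ≤ a) {ψ : K}
    (σ : K →+* ℝ) : differenceLattice (σ '' triangleSTilde a ψ) =
      AddSubgroup.closure {1, ((a - 1 : ℤ) : ℝ) * σ ψ + ((-1 : ℤ) : ℝ) * σ ψ ^ 2} := by
  have hmem (v u : ℤ) (hv : 1 ≤ v) (hv' : v ≤ a - 3) (hu : 0 ≤ u) (hu' : u ≤ v)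
      (hvu : (v, u) ≠ (1, 0)) :
      ((1 + v - u + a * u : ℤ) : ℝ) + ((a - u + a * u : ℤ) : ℝ) * σ ψ
        - ((u + 1 : ℤ) : ℝ) * σ ψ ^ 2 ∈ σ '' triangleSTilde a ψ :=
    ⟨_, ⟨v, u, hv, hv', hu, hu', hvu, rfl⟩, by
      simp only [map_add, map_sub, map_mul, map_pow, map_intCast]⟩
  have h11 := hmem 1 1 le_rfl (by lia) (by simp) (by lia) (by simp)
  have h21 := hmem 2 1 (by lia) (by lia) (by simp) (by lia) (by simp)
  have h22 := hmem 2 2 (by lia) (by lia) (by simp) (by lia) (by simp)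
  have h1 : (1 : ℝ) ∈ differenceLattice (σ '' triangleSTilde a ψ) := by
    convert sub_mem_differenceLattice h21 h11 using 1
    push_cast
    ring
  refine differenceLattice_eq_closure_pair (sub_mem_of_mem_triangleSTilde σ) h1 ?_
  -- `λ̃₂₂ - λ̃₂₁ = (a - 1) + θ` with `θ = (a - 1)ψ - ψ²`.
  convert sub_mem (sub_mem_differenceLattice h22 h21) (zsmul_mem h1 (a - 1)) using 1
  rw [zsmul_eq_mul]
  push_cast
  ring

theorem mainTheorem9 {K : Type*} [Field K] [NumberField K] (a : ℤ) :
    (3 ≤ a → ∀ ρ : K, ρ ^ 3 + ((a : K) - 1) * ρ ^ 2 - (a : K) * ρ - 1 = 0 →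
      IntermediateField.adjoin ℚ {ρ} = ⊤ →
      ∀ (σ : K →+* ℝ) (k : ℕ) (ε : (𝓞 K)ˣ),
        differenceLattice (σ '' triangleS a ρ) =
          AddSubgroup.closure {(convergent σ ρ k 0 : ℝ) * σ ((ε : 𝓞 K) : K),
            (convergent σ ρ k 1 : ℝ) * σ ((ε : 𝓞 K) : K)} →
        |Algebra.norm ℚ (convergent σ ρ k 2)| ≤ (a : ℚ) ^ 2 - 5 * (a : ℚ) →
        ∃ η : (𝓞 K)ˣ, (η = ε ∨ η = -ε) ∧
          σ '' triangleS a ρ ⊆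
            latticeCoset ((convergent σ ρ k 2 : ℝ) * σ ((η : 𝓞 K) : K))
              (differenceLattice (σ '' triangleS a ρ))) ∧
    (5 ≤ a → ∀ ψ : K, ψ ^ 3 - ((a : K) - 1) * ψ ^ 2 - (a : K) * ψ - 1 = 0 →
      IntermediateField.adjoin ℚ {ψ} = ⊤ →
      ∀ (σ : K →+* ℝ) (k : ℕ) (ε : (𝓞 K)ˣ),
        differenceLattice (σ '' triangleSTilde a ψ) =
          AddSubgroup.closure {(convergent σ ψ k 0 : ℝ) * σ ((ε : 𝓞 K) : K),
            (convergent σ ψ k 1 : ℝ) * σ ((ε : 𝓞 K) : K)} →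
        |Algebra.norm ℚ (convergent σ ψ k 2)| ≤ (a : ℚ) ^ 2 - 5 * (a : ℚ) →
        ∃ η : (𝓞 K)ˣ, (η = ε ∨ η = -ε) ∧
          σ '' triangleSTilde a ψ ⊆
            latticeCoset ((convergent σ ψ k 2 : ℝ) * σ ((η : 𝓞 K) : K))
              (differenceLattice (σ '' triangleSTilde a ψ))) := by
  refine ⟨fun ha ρ hρ _ σ k ε hε _ => ?_, fun ha ψ hψ _ σ k ε hε _ => ?_⟩
  · have ht : σ ρ ^ 3 = ((1 - a : ℤ) : ℝ) * σ ρ ^ 2 + (a : ℝ) * σ ρ + 1 := by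
      have h := congrArg σ hρ
      simp only [map_add, map_sub, map_mul, map_pow, map_intCast, map_one, map_zero] at h
      push_cast
      linear_combination h
    have hL := differenceLattice_triangleS ha (ρ := ρ) σ
    exact exists_unit_subset_latticeCoset σ ht (by lia) (by lia) (by norm_num) hL
      (hL ▸ sub_mem_of_mem_triangleS σ) k ε hε
  · have ht : σ ψ ^ 3 = ((a - 1 : ℤ) : ℝ) * σ ψ ^ 2 + (a : ℝ) * σ ψ + 1 := by
      have h := congrArg σ hψ
      simp only [map_sub, map_mul, map_pow, map_intCast, map_one, map_zero] at h
      push_cast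
      linear_combination h
    have hL := differenceLattice_triangleSTilde ha (ψ := ψ) σ
    exact exists_unit_subset_latticeCoset σ ht (by lia) (by lia) (by norm_num) hL
      (hL ▸ sub_mem_of_mem_triangleSTilde σ) k ε hε
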